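/- Let $\mathcal{C}$ be a finitely cocomplete homological category, that is, a pointed, regular (in particular finitely complete), protomodular category with finite colimits. Let $x\colon X\to D$ and $y\colon Y\to D$ be normal monomorphisms (i.e., kernels) and let $w\colon W\to D$ be any morphism. Write $[1_W,0]\colon W+X\to W$ and $[1_W,0]\colon W+Y\to W$ for the morphisms that are the identity on $W$ and zero on the other summand, $\iota_W$ for the coproduct inclusions of $W$, and $(W+X)\times_W(W+Y)$ for the pullback of these two morphisms. One says that $x$ and $y$ commute over $w$ if there is a morphism $\varphi\colon (W+X)\times_W(W+Y)\to D$ such that $$\varphi\circ\langle 1_{W+X},\ \iota_W\circ[1_W,0]\rangle=[w,x]\colon W+X\to D \quad\text{and}\quad \varphi\circ\langle \iota_W\circ[1_W,0],\ 1_{W+Y}\rangle=[w,y]\colon W+Y\to D.$$ For subobjects $K,L,M$ of $D$, the commutator $[K,L]\leq D$ is the image of the composite of the kernel of the canonical morphism $K+L\to K\times L$ with the induced morphism $K+L\to D$; and $[K,L,M]\leq D$ is the image of the composite of the kernel of the canonical morphism $K+L+M\to (K+L)\times(K+M)\times(L+M)$ (whose components send $M$, $L$, $K$ to zero, respectively,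 and include the other two summands) with the induced morphism $K+L+M\to D$. Then $x$ and $y$ commute over $w$ if and only if $[X,Y]=0$ and $[X,Y,\operatorname{Im}(w)]=0$, where $X$ and $Y$ are regarded as subobjects of $D$ via $x$ and $y$, and $\operatorname{Im}(w)\leq D$ is the image of $w$. -/

import Mathlib

open CategoryTheory CategoryTheory.Limits

universe v u

namespace WeightedCommutator

/-- A category with pullbacks is protomodular when, for every `v : E ⟶ B`, the change-of-base
functor from points (split epimorphisms with a chosen section) over `B` to points over `E` reflects
isomorphisms: a morphism `f` of points over `B`, from `(p, s)` to `(p', s')`, is invertible as soon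
as the morphism `g` which it induces between the pullbacks along `v` is invertible. -/
class Protomodular (C : Type u) [Category.{v} C] : Prop where
  isIso_of_isIso_pullback {A A' B E P P' : C}
    {p : A ⟶ B} {s : B ⟶ A} (_ : s ≫ p = 𝟙 B)
    {p' : A' ⟶ B} {s' : B ⟶ A'} (_ : s' ≫ p' = 𝟙 B)
    (f : A ⟶ A') (_ : f ≫ p' = p) (_ : s ≫ f = s')
    (v : E ⟶ B)
    {a : P ⟶ A} {e : P ⟶ E} (_ : IsPullback a e p v)
    {a' : P' ⟶ A'} {e' : P' ⟶ E} (_ : IsPullback a' e' p' v)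
    (g : P ⟶ P') (_ : g ≫ a' = a ≫ f) (_ : g ≫ e' = e) (_ : IsIso g) : IsIso f

/-- A homological category: a pointed, regular (in particular finitely complete), protomodular
category. -/
class Homological (C : Type u) [Category.{v} C] [HasZeroMorphisms C] : Prop extends
  HasZeroObject C, Regular C, Protomodular C

noncomputable section

variable {C : Type u} [Category.{v} C] [HasZeroMorphisms C] [Homological C] [HasFiniteColimits C]

/-- The split epimorphism `[1_W, 0] : W + X ⟶ W`. -/
def splitProj (W X : C) : W ⨿ X ⟶ W :=
  coprod.desc (𝟙 W) 0

theorem inl_splitProj (W X : C) : (coprod.inl : W ⟶ W ⨿ X) ≫ splitProj W X = 𝟙 W :=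
  coprod.inl_desc _ _

/-- The morphism `⟨1, ι_W ∘ [1_W, 0]⟩ : W + X ⟶ (W + X) ×_W (W + Y)`. -/
def leftInclusion (W X Y : C) : W ⨿ X ⟶ pullback (splitProj W X) (splitProj W Y) :=
  pullback.lift (𝟙 (W ⨿ X)) (splitProj W X ≫ coprod.inl) (by simp [inl_splitProj])

/-- The morphism `⟨ι_W ∘ [1_W, 0], 1⟩ : W + Y ⟶ (W + X) ×_W (W + Y)`. -/
def rightInclusion (W X Y : C) : W ⨿ Y ⟶ pullback (splitProj W X) (splitProj W Y) :=
  pullback.lift (splitProj W Y ≫ coprod.inl) (𝟙 (W ⨿ Y)) (by simp [inl_splitProj])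

/-- The morphisms `x` and `y` of the weighted cospan `(x, y, w)` commute over the weight `w`:
there is an internal multiplication `φ : (W + X) ×_W (W + Y) ⟶ D`. -/
def CommuteOver {W X Y D : C} (x : X ⟶ D) (y : Y ⟶ D) (w : W ⟶ D) : Prop :=
  ∃ φ : pullback (splitProj W X) (splitProj W Y) ⟶ D,
    leftInclusion W X Y ≫ φ = coprod.desc w x ∧ rightInclusion W X Y ≫ φ = coprod.desc w y

/-- The canonical comparison `K + L ⟶ K × L`. -/
def binaryComparison (K L : C) : K ⨿ L ⟶ K ⨯ L :=
  prod.lift (coprod.desc (𝟙 K) 0) (coprod.desc 0 (𝟙 L))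

/-- The (Higgins) commutator `[K, L]` of two subobjects `k : K ⟶ X` and `l : L ⟶ X`: the image in
`X` of the co-smash product `K ⋄ L`, the kernel of `K + L ⟶ K × L`. -/
def commutator₂ {X K L : C} (k : K ⟶ X) (l : L ⟶ X) [Mono k] [Mono l] : Subobject X :=
  imageSubobject (kernel.ι (binaryComparison K L) ≫ coprod.desc k l)

/-- The canonical morphism `K + L + M ⟶ (K + L) × (K + M) × (L + M)`, whose components send,
respectively, `M`, `L` and `K` to zero. -/
def ternaryComparison (K L M : C) : K ⨿ (L ⨿ M) ⟶ (K ⨿ L) ⨯ ((K ⨿ M) ⨯ (L ⨿ M)) :=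
  prod.lift (coprod.desc coprod.inl (coprod.desc coprod.inr 0))
    (prod.lift (coprod.desc coprod.inl (coprod.desc 0 coprod.inr))
      (coprod.desc 0 (coprod.desc coprod.inl coprod.inr)))

/-- The ternary commutator `[K, L, M]` of three subobjects of `X`: the image in `X` of the ternary
co-smash product `K ⋄ L ⋄ M`, the kernel of `K + L + M ⟶ (K + L) × (K + M) × (L + M)`. -/
def commutator₃ {X K L M : C} (k : K ⟶ X) (l : L ⟶ X) (m : M ⟶ X) [Mono k] [Mono l] [Mono m] :
    Subobject X :=
  imageSubobject (kernel.ι (ternaryComparison K L M) ≫ coprod.desc k (coprod.desc l m))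

end

end WeightedCommutator

namespace WeightedCommutator

attribute [local simp] pullback.lift_fst pullback.lift_snd pullback.lift_fst_assoc
  pullback.lift_snd_assoc coprod.inl_desc coprod.inr_desc coprod.inl_desc_assoc
  coprod.inr_desc_assoc prod.lift_fst prod.lift_snd prod.lift_fst_assoc prod.lift_snd_assoc

/-! The canonical map `toPullback` from X + Y + W to (W + X) ×_W (W + Y) is a strong, hence regular,
epimorphism, so it is the cokernel of its kernel K. Thus φ exists iff [x, y, w] vanishes on K
(`commuteOver_iff_kernel`). Killing W sends K to X ⋄ Y; this is split by the inclusion of X + Y and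
has kernel X ⋄ Y ⋄ W. A section and a kernel are jointly epic, so vanishing on K means vanishing on
both co-smash products, which for monic w says that the two commutators are zero. For general w, a
strong epimorphism W → W' induces a regular epimorphism between the corresponding K's, so only the
image of w matters (`commuteOver_strongEpi_comp_iff`). -/

theorem strongEpi_coprod_map {C : Type u} [Category.{v} C] [HasFiniteColimits C]
    {A A' B B' : C} (f : A ⟶ A') (g : B ⟶ B')
    [StrongEpi f] [StrongEpi g] : StrongEpi (coprod.map f g) where
  epi := inferInstance
  llp := fun {X Y} z _ ↦ ⟨fun {u v} sq ↦ by
    have hf : CommSq (coprod.inl ≫ u) f z (coprod.inl ≫ v) := ⟨by simp [sq.w]⟩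
    have hg : CommSq (coprod.inr ≫ u) g z (coprod.inr ≫ v) := ⟨by simp [sq.w]⟩
    exact ⟨⟨{ l := coprod.desc hf.lift hg.lift
              fac_left := by apply coprod.hom_ext <;> simp
              fac_right := by apply coprod.hom_ext <;> simp }⟩⟩⟩

/-! ### Exactness properties of homological categories -/

variable {C : Type u} [Category.{v} C] [HasZeroMorphisms C]

theorem isPullback_kernel_ι [HasZeroObject C] {A B Z : C} (p : A ⟶ B) [HasKernel p]
    (hZ : IsZero Z) :
    IsPullback (kernel.ι p) (0 : kernel p ⟶ Z) p (0 : Z ⟶ B) :=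
  IsPullback.mk' (by simp) (fun _ _ _ h _ ↦ (cancel_mono (kernel.ι p)).1 h)
    (fun _ a b h ↦ ⟨kernel.lift p a (by simpa using h), by simp, hZ.eq_of_tgt _ _⟩)

variable [Homological C]

/-- In a homological category, a subobject of a point which contains the section and the kernel is
everything. -/
theorem isIso_of_mono_of_section_of_kernel {A B M : C} {p : A ⟶ B} {s : B ⟶ A} (hs : s ≫ p = 𝟙 B)
    (m : M ⟶ A) [Mono m] {s' : B ⟶ M} (hs' : s' ≫ m = s)
    {k' : kernel p ⟶ M} (hk' : k' ≫ m = kernel.ι p) : IsIso m := by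
  obtain ⟨Z, hZ⟩ := HasZeroObject.zero (C := C)
  -- As `kernel p` factors through M, `m ≫ p` and p have the same kernel; protomodularity then
  -- applies to base change along 0 → B.
  have hP : IsPullback k' (0 : kernel p ⟶ Z) (m ≫ p) (0 : Z ⟶ B) := by
    refine IsPullback.mk' (by simp [← Category.assoc, hk']) (fun _ φ φ' h _ ↦ ?_)
      (fun T a b h ↦ ⟨kernel.lift p (a ≫ m) (by simpa using h), ?_, hZ.eq_of_tgt _ _⟩)
    · rw [← cancel_mono (kernel.ι p), ← hk', reassoc_of% h]
    · rw [← cancel_mono m, Category.assoc, hk', kernel.lift_ι]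
  exact Protomodular.isIso_of_isIso_pullback (p := m ≫ p) (s := s') (by rw [reassoc_of% hs', hs])
    hs m rfl hs' (0 : Z ⟶ B) hP (isPullback_kernel_ι p hZ) (𝟙 _) (by simp [hk']) (by simp)
    inferInstance

/-- In a homological category, the section and the kernel of a point are jointly epic. -/
theorem hom_ext_of_section_of_kernel {A B D : C} {p : A ⟶ B} {s : B ⟶ A} (hs : s ≫ p = 𝟙 B)
    {f g : A ⟶ D} (h : s ≫ f = s ≫ g) (hk : kernel.ι p ≫ f = kernel.ι p ≫ g) : f = g := by
  have : IsIso (equalizer.ι f g) :=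
    isIso_of_mono_of_section_of_kernel hs _ (equalizer.lift_ι s h)
      (equalizer.lift_ι (kernel.ι p) hk)
  exact (cancel_epi (equalizer.ι f g)).1 (equalizer.condition f g)

/-- A form of the short five lemma for regular epimorphisms. -/
theorem isIso_of_mono_of_regularEpi_of_kernel {M Q R : C} (m : M ⟶ Q) [Mono m] (r : Q ⟶ R)
    [IsRegularEpi (m ≫ r)] {k' : kernel r ⟶ M} (hk' : k' ≫ m = kernel.ι r) : IsIso m := by
  -- f is a base change of m and a morphism of points over M. The kernel of its target point is that
  -- of r, which lies in M, so f is invertible.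
  let f : pullback (m ≫ r) (m ≫ r) ⟶ pullback (m ≫ r) r :=
    pullback.lift (pullback.fst _ _) (pullback.snd _ _ ≫ m) (by simp [pullback.condition])
  have hf₁ : f ≫ pullback.fst _ _ = pullback.fst _ _ := pullback.lift_fst _ _ _
  have hf₂ : f ≫ pullback.snd _ _ = pullback.snd _ _ ≫ m := pullback.lift_snd _ _ _
  have : Mono f := ⟨fun a b h ↦ by
    apply pullback.hom_ext
    · rw [← hf₁, reassoc_of% h]
    · rw [← cancel_mono m, Category.assoc, Category.assoc, ← hf₂, reassoc_of% h]⟩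
  let t := kernel.lift r (kernel.ι (pullback.fst (m ≫ r) r) ≫ pullback.snd _ _)
    (by rw [Category.assoc, ← pullback.condition, kernel.condition_assoc, zero_comp])
  have ht : t ≫ k' ≫ m = kernel.ι (pullback.fst (m ≫ r) r) ≫ pullback.snd _ _ := by
    simp [t, hk']
  have : IsIso f := isIso_of_mono_of_section_of_kernel (p := pullback.fst (m ≫ r) r)
    (s := pullback.lift (𝟙 _) m (by simp)) (by simp) f (s' := pullback.lift (𝟙 _) (𝟙 _))
    (by apply pullback.hom_ext <;> simp [hf₁, hf₂])
    (k' := pullback.lift 0 (t ≫ k')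
      (by rw [Category.assoc, reassoc_of% ht, ← pullback.condition, kernel.condition_assoc]))
    (by apply pullback.hom_ext <;> simp [hf₁, hf₂, ht])
  -- The projection to Q, a base change of `m ≫ r`, now factors through m.
  have h : (inv f ≫ pullback.snd _ _) ≫ m = pullback.snd (m ≫ r) r := by simp [← hf₂]
  have : StrongEpi ((inv f ≫ pullback.snd (m ≫ r) (m ≫ r)) ≫ m) := by rw [h]; infer_instance
  have : StrongEpi m := strongEpi_of_strongEpi (inv f ≫ pullback.snd (m ≫ r) (m ≫ r)) m
  exact isIso_of_mono_of_strongEpi m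

/-- In a homological category, a regular epimorphism between points induces a regular epimorphism
between their kernels. -/
theorem isRegularEpi_kernel_map {A B A' B' : C} {p : A ⟶ B} {s : B ⟶ A} (hs : s ≫ p = 𝟙 B)
    {p' : A' ⟶ B'} {s' : B' ⟶ A'} (f : A ⟶ A') (g : B ⟶ B') [IsRegularEpi f]
    (hp : p ≫ g = f ≫ p') (hsf : s ≫ f = g ≫ s') : IsRegularEpi (kernel.map p p' f g hp) := by
  let c : A ⟶ pullback g p' := pullback.lift p f hp
  have hc₁ : c ≫ pullback.fst _ _ = p := pullback.lift_fst _ _ _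
  have hc₂ : c ≫ pullback.snd _ _ = f := pullback.lift_snd _ _ _
  have hr : factorThruImage c ≫ image.ι c ≫ pullback.snd _ _ = f := by simp [hc₂]
  have : StrongEpi (factorThruImage c ≫ image.ι c ≫ pullback.snd g p') := by
    rw [hr]; infer_instance
  have : StrongEpi (image.ι c ≫ pullback.snd g p') := strongEpi_of_strongEpi (factorThruImage c) _
  have hker : kernel.ι (pullback.snd g p') ≫ pullback.fst _ _ ≫ g = 0 := by
    simp [pullback.condition]
  -- A pair (b, 0) with g b = 0 equals c (s b), since f (s b) = s' (g b) = 0.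
  have : IsIso (image.ι c) := isIso_of_mono_of_regularEpi_of_kernel (image.ι c) (pullback.snd g p')
    (k' := kernel.ι (pullback.snd g p') ≫ pullback.fst _ _ ≫ s ≫ factorThruImage c) (by
      apply pullback.hom_ext
      · simp [hc₁, hs]
      · simp [hc₂, hsf, reassoc_of% hker])
  have : StrongEpi c := by
    rw [← image.fac c]
    exact strongEpi_comp _ _
  -- The map between kernels is a base change of c.
  have hP : IsPullback (kernel.ι p) (kernel.map p p' f g hp) c
      (pullback.lift 0 (kernel.ι p') (by simp)) := by
    refine IsPullback.mk' ?_ (fun _ _ _ h _ ↦ (cancel_mono (kernel.ι p)).1 h)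
      (fun T a b h ↦ ⟨kernel.lift p a ?_, kernel.lift_ι _ _ _, ?_⟩)
    · apply pullback.hom_ext <;> simp [hc₁, hc₂]
    · simpa [hc₁] using h =≫ pullback.fst _ _
    · simpa [← cancel_mono (kernel.ι p'), hc₂] using h =≫ pullback.snd _ _
  exact Regular.regularEpiIsStableUnderBaseChange.of_isPullback hP
    (inferInstanceAs (IsRegularEpi c))

/-- In a homological category, a regular epimorphism is the cokernel of its kernel. -/
theorem exists_comp_eq_of_kernel_ι_comp_eq_zero {A P D : C} (q : A ⟶ P) [IsRegularEpi q]
    (h : A ⟶ D) (hq : kernel.ι q ≫ h = 0) : ∃ φ, q ≫ φ = h := by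
  -- The kernel pair is a point split by the diagonal, and its kernel maps into that of q, where h
  -- vanishes.
  have key : pullback.fst q q ≫ h = pullback.snd q q ≫ h := by
    refine hom_ext_of_section_of_kernel (p := pullback.fst q q)
      (s := pullback.lift (𝟙 _) (𝟙 _)) (by simp) (by simp) ?_
    have : kernel.lift q (kernel.ι (pullback.fst q q) ≫ pullback.snd q q)
        (by simp [← pullback.condition]) ≫ kernel.ι q ≫ h = 0 := by rw [hq, comp_zero]
    simpa using this.symm
  refine ⟨IsRegularEpi.desc q h ?_, IsRegularEpi.fac q h _⟩
  simpa using pullback.lift (IsRegularEpi.left q) (IsRegularEpi.right q) (IsRegularEpi.w q) ≫= key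

theorem imageSubobject_eq_bot_iff {A B : C} (f : A ⟶ B) : imageSubobject f = ⊥ ↔ f = 0 := by
  constructor
  · intro h
    rw [← Subobject.bot_factors_iff_zero, ← h]
    exact (Subobject.factors_iff _ _).2 ⟨_, imageSubobject_arrow_comp f⟩
  · rintro rfl
    exact imageSubobject_zero

/-! ### The canonical map onto (W + X) ×_W (W + Y) -/

variable [HasFiniteColimits C]

/-- The morphism `X + Y + W ⟶ W + X` which is zero on `Y`. -/
noncomputable def dropSnd (X Y W : C) : X ⨿ (Y ⨿ W) ⟶ W ⨿ X :=
  coprod.desc coprod.inr (coprod.desc 0 coprod.inl)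

/-- The morphism `X + Y + W ⟶ W + Y` which is zero on `X`. -/
noncomputable def dropFst (X Y W : C) : X ⨿ (Y ⨿ W) ⟶ W ⨿ Y :=
  coprod.desc 0 (coprod.desc coprod.inr coprod.inl)

/-- The morphism `X + Y + W ⟶ X + Y` which is zero on `W`. -/
noncomputable def dropWeight (X Y W : C) : X ⨿ (Y ⨿ W) ⟶ X ⨿ Y :=
  coprod.desc coprod.inl (coprod.desc coprod.inr 0)

/-- The canonical morphism `X + Y + W ⟶ (W + X) ×_W (W + Y)`. -/
noncomputable def toPullback (X Y W : C) :
    X ⨿ (Y ⨿ W) ⟶ pullback (splitProj W X) (splitProj W Y) :=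
  pullback.lift (dropSnd X Y W) (dropFst X Y W) (by
    apply coprod.hom_ext
    · simp [dropSnd, dropFst, splitProj]
    · apply coprod.hom_ext <;> simp [dropSnd, dropFst, splitProj])

theorem toPullback_fst (X Y W : C) : toPullback X Y W ≫ pullback.fst _ _ = dropSnd X Y W :=
  pullback.lift_fst _ _ _

theorem toPullback_snd (X Y W : C) : toPullback X Y W ≫ pullback.snd _ _ = dropFst X Y W :=
  pullback.lift_snd _ _ _

theorem leftInclusion_fst (W X Y : C) : leftInclusion W X Y ≫ pullback.fst _ _ = 𝟙 _ :=
  pullback.lift_fst _ _ _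

theorem leftInclusion_snd (W X Y : C) :
    leftInclusion W X Y ≫ pullback.snd _ _ = splitProj W X ≫ coprod.inl :=
  pullback.lift_snd _ _ _

theorem rightInclusion_fst (W X Y : C) :
    rightInclusion W X Y ≫ pullback.fst _ _ = splitProj W Y ≫ coprod.inl :=
  pullback.lift_fst _ _ _

theorem rightInclusion_snd (W X Y : C) : rightInclusion W X Y ≫ pullback.snd _ _ = 𝟙 _ :=
  pullback.lift_snd _ _ _

theorem desc_comp_toPullback_left (X Y W : C) :
    coprod.desc (coprod.inr ≫ coprod.inr) coprod.inl ≫ toPullback X Y W = leftInclusion W X Y := by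
  apply pullback.hom_ext
  · rw [Category.assoc, toPullback_fst, leftInclusion_fst]
    apply coprod.hom_ext <;> simp [dropSnd]
  · rw [Category.assoc, toPullback_snd, leftInclusion_snd]
    apply coprod.hom_ext <;> simp [dropFst, splitProj]

theorem desc_comp_toPullback_right (X Y W : C) :
    coprod.desc (coprod.inr ≫ coprod.inr) (coprod.inl ≫ coprod.inr) ≫ toPullback X Y W =
      rightInclusion W X Y := by
  apply pullback.hom_ext
  · rw [Category.assoc, toPullback_fst, rightInclusion_fst]
    apply coprod.hom_ext <;> simp [dropSnd, splitProj]
  · rw [Category.assoc, toPullback_snd, rightInclusion_snd]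
    apply coprod.hom_ext <;> simp [dropFst]

/-- The image contains `rightInclusion`, a section of the second projection, and the kernel of that
projection, whose elements (a, 0) are values of `leftInclusion`. -/
instance strongEpi_toPullback (X Y W : C) : StrongEpi (toPullback X Y W) := by
  have hs : rightInclusion W X Y ≫ pullback.snd _ _ = 𝟙 (W ⨿ Y) :=
    rightInclusion_snd W X Y
  have hk : kernel.ι (pullback.snd (splitProj W X) (splitProj W Y)) ≫ pullback.fst _ _ ≫
      leftInclusion W X Y = kernel.ι _ := by
    apply pullback.hom_ext
    · simp [leftInclusion_fst]
    · simp [leftInclusion_snd, pullback.condition_assoc]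
  have : IsIso (image.ι (toPullback X Y W)) :=
    isIso_of_mono_of_section_of_kernel hs _
      (s' := coprod.desc (coprod.inr ≫ coprod.inr) (coprod.inl ≫ coprod.inr) ≫
        factorThruImage (toPullback X Y W))
      (by rw [Category.assoc, image.fac, desc_comp_toPullback_right])
      (k' := kernel.ι _ ≫ pullback.fst _ _ ≫ coprod.desc (coprod.inr ≫ coprod.inr) coprod.inl ≫
        factorThruImage (toPullback X Y W))
      (by simp only [Category.assoc, image.fac]; rw [desc_comp_toPullback_left, hk])
  rw [← image.fac (toPullback X Y W)]
  exact strongEpi_comp _ _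

/-- Commutation over a weight, expressed through the kernel of
`X + Y + W ⟶ (W + X) ×_W (W + Y)`. -/
theorem commuteOver_iff_kernel {W X Y D : C} (x : X ⟶ D) (y : Y ⟶ D) (w : W ⟶ D) :
    CommuteOver x y w ↔ ∀ ⦃Z : C⦄ (t : Z ⟶ X ⨿ (Y ⨿ W)), t ≫ dropSnd X Y W = 0 →
      t ≫ dropFst X Y W = 0 → t ≫ coprod.desc x (coprod.desc y w) = 0 := by
  constructor
  · rintro ⟨φ, hl, hr⟩ Z t h₁ h₂
    have hφ : toPullback X Y W ≫ φ = coprod.desc x (coprod.desc y w) := by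
      rw [← desc_comp_toPullback_left] at hl
      rw [← desc_comp_toPullback_right] at hr
      apply coprod.hom_ext
      · simpa using coprod.inr ≫= hl
      · apply coprod.hom_ext
        · simpa using coprod.inr ≫= hr
        · simpa using coprod.inl ≫= hl
    have ht : t ≫ toPullback X Y W = 0 := by
      apply pullback.hom_ext <;> simp [toPullback_fst, toPullback_snd, h₁, h₂]
    rw [← hφ, reassoc_of% ht, zero_comp]
  · intro h
    obtain ⟨φ, hφ⟩ := exists_comp_eq_of_kernel_ι_comp_eq_zero (toPullback X Y W)
      (coprod.desc x (coprod.desc y w)) (h _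
        (by rw [← toPullback_fst, kernel.condition_assoc, zero_comp])
        (by rw [← toPullback_snd, kernel.condition_assoc, zero_comp]))
    refine ⟨φ, ?_, ?_⟩
    · rw [← desc_comp_toPullback_left, Category.assoc, hφ]
      apply coprod.hom_ext <;> simp
    · rw [← desc_comp_toPullback_right, Category.assoc, hφ]
      apply coprod.hom_ext <;> simp

/-! ### Replacing the weight by its image -/

/-- Commutation over a weight only depends on the image of the weight. -/
theorem commuteOver_strongEpi_comp_iff {W W' X Y D : C} (x : X ⟶ D) (y : Y ⟶ D) (e : W ⟶ W')
    [StrongEpi e] (w : W' ⟶ D) : CommuteOver x y (e ≫ w) ↔ CommuteOver x y w := by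
  rw [commuteOver_iff_kernel, commuteOver_iff_kernel]
  let f : X ⨿ (Y ⨿ W) ⟶ X ⨿ (Y ⨿ W') := coprod.map (𝟙 X) (coprod.map (𝟙 Y) e)
  let gX : W ⨿ X ⟶ W' ⨿ X := coprod.map e (𝟙 X)
  let gY : W ⨿ Y ⟶ W' ⨿ Y := coprod.map e (𝟙 Y)
  have hf : f ≫ coprod.desc x (coprod.desc y w) = coprod.desc x (coprod.desc y (e ≫ w)) := by
    apply coprod.hom_ext
    · simp [f]
    · apply coprod.hom_ext <;> simp [f]
  have hfX : dropSnd X Y W ≫ gX = f ≫ dropSnd X Y W' := by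
    apply coprod.hom_ext
    · simp [f, gX, dropSnd]
    · apply coprod.hom_ext <;> simp [f, gX, dropSnd]
  have hfY : dropFst X Y W ≫ gY = f ≫ dropFst X Y W' := by
    apply coprod.hom_ext
    · simp [f, gY, dropFst]
    · apply coprod.hom_ext <;> simp [f, gY, dropFst]
  constructor
  · intro h
    have : StrongEpi (coprod.map (𝟙 Y) e) := strongEpi_coprod_map _ _
    have : StrongEpi f := strongEpi_coprod_map _ _
    have : StrongEpi gY := strongEpi_coprod_map _ _
    let s (V : C) : V ⨿ X ⟶ X ⨿ (Y ⨿ V) := coprod.desc (coprod.inr ≫ coprod.inr) coprod.inl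
    have hs (V : C) : s V ≫ dropSnd X Y V = 𝟙 _ := by
      apply coprod.hom_ext <;> simp [s, dropSnd]
    have hsf : s W ≫ f = gX ≫ s W' := by
      apply coprod.hom_ext <;> simp [s, f, gX]
    let α := kernel.map _ _ f gX hfX
    have : IsRegularEpi α := isRegularEpi_kernel_map (hs W) f gX hfX hsf
    have hproj (V : C) : dropFst X Y V ≫ splitProj V Y =
        dropSnd X Y V ≫ splitProj V X := by
      apply coprod.hom_ext
      · simp [splitProj, dropSnd, dropFst]
      · apply coprod.hom_ext <;> simp [splitProj, dropSnd, dropFst]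
    -- K is reached by taking kernels twice: it is the kernel of the map that `dropFst` induces on
    -- the kernel of `dropSnd`. Both stages are split naturally in V, so `isRegularEpi_kernel_map`
    -- applies at each.
    let p (V : C) : kernel (dropSnd X Y V) ⟶ kernel (splitProj V Y) :=
      kernel.map _ _ (dropFst X Y V) (splitProj V X) (hproj V).symm
    let r (V : C) : V ⨿ Y ⟶ X ⨿ (Y ⨿ V) :=
      coprod.desc (coprod.inr ≫ coprod.inr) (coprod.inl ≫ coprod.inr)
    have hpι (V : C) : p V ≫ kernel.ι _ = kernel.ι _ ≫ dropFst X Y V := kernel.lift_ι _ _ _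
    have hrdrop (V : C) : r V ≫ dropFst X Y V = 𝟙 _ := by
      apply coprod.hom_ext <;> simp [r, dropFst]
    let s₂ (V : C) : kernel (splitProj V Y) ⟶ kernel (dropSnd X Y V) :=
      kernel.map _ _ (r V) coprod.inl
        (by apply coprod.hom_ext <;> simp [r, dropSnd, splitProj])
    have hs₂ (V : C) : s₂ V ≫ p V = 𝟙 _ := by
      rw [← cancel_mono (kernel.ι _)]
      simp [s₂, p, hrdrop]
    have hg : splitProj W Y ≫ e = gY ≫ splitProj W' Y := by
      apply coprod.hom_ext <;> simp [splitProj, gY]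
    let β := kernel.map _ _ gY e hg
    have hp : p W ≫ β = α ≫ p W' := by
      rw [← cancel_mono (kernel.ι _)]
      simp [p, β, α, hfY]
    have hrf : r W ≫ f = gY ≫ r W' := by
      apply coprod.hom_ext <;> simp [r, f, gY]
    have hsα : s₂ W ≫ α = β ≫ s₂ W' := by
      rw [← cancel_mono (kernel.ι _)]
      simp [s₂, β, α, hrf]
    have hreg : IsRegularEpi (kernel.map (p W) (p W') α β hp) :=
      isRegularEpi_kernel_map (hs₂ W) α β hp hsα
    have key : kernel.ι (p W') ≫ kernel.ι _ ≫ coprod.desc x (coprod.desc y w) = 0 := by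
      rw [← cancel_epi (kernel.map (p W) (p W') α β hp)]
      have := h (kernel.ι (p W) ≫ kernel.ι _) (by simp)
        (by rw [Category.assoc, ← hpι, kernel.condition_assoc, zero_comp])
      rw [← hf] at this
      simpa [α] using this
    intro Z t h₁ h₂
    have hz : kernel.lift _ t h₁ ≫ p W' = 0 := by
      rw [← cancel_mono (kernel.ι _)]
      simp [p, h₂]
    simpa using kernel.lift _ _ hz ≫= key
  · intro h Z t h₁ h₂
    rw [← hf, ← Category.assoc]
    apply h
    · rw [Category.assoc, ← hfX, reassoc_of% h₁, zero_comp]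
    · rw [Category.assoc, ← hfY, reassoc_of% h₂, zero_comp]

/-! ### Commutators and the split extension -/

theorem commutator₂_eq_bot_iff {X Y D : C} (x : X ⟶ D) (y : Y ⟶ D) [Mono x] [Mono y] :
    commutator₂ x y = ⊥ ↔ kernel.ι (binaryComparison X Y) ≫ coprod.desc x y = 0 :=
  imageSubobject_eq_bot_iff _

/-- Up to swapping summands, the components of `ternaryComparison` are the three drop maps. -/
theorem commutator₃_eq_bot_iff {W X Y D : C} (x : X ⟶ D) (y : Y ⟶ D) (w : W ⟶ D)
    [Mono x] [Mono y] [Mono w] :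
    commutator₃ x y w = ⊥ ↔
      ∀ ⦃Z : C⦄ (t : Z ⟶ X ⨿ (Y ⨿ W)), t ≫ dropSnd X Y W = 0 → t ≫ dropFst X Y W = 0 →
        t ≫ dropWeight X Y W = 0 → t ≫ coprod.desc x (coprod.desc y w) = 0 := by
  have hX : ternaryComparison X Y W ≫ prod.snd ≫ prod.fst =
      dropSnd X Y W ≫ (coprod.braiding W X).hom := by
    apply coprod.hom_ext
    · simp [ternaryComparison, dropSnd]
    · apply coprod.hom_ext <;> simp [ternaryComparison, dropSnd]
  have hY : ternaryComparison X Y W ≫ prod.snd ≫ prod.snd =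
      dropFst X Y W ≫ (coprod.braiding W Y).hom := by
    apply coprod.hom_ext
    · simp [ternaryComparison, dropFst]
    · apply coprod.hom_ext <;> simp [ternaryComparison, dropFst]
  have hW : ternaryComparison X Y W ≫ prod.fst = dropWeight X Y W := prod.lift_fst _ _
  refine (imageSubobject_eq_bot_iff _).trans ⟨fun h Z t ht₁ ht₂ ht₃ ↦ ?_, fun h ↦ h _ ?_ ?_ ?_⟩
  · have ht : t ≫ ternaryComparison X Y W = 0 := by
      apply Limits.prod.hom_ext
      · rw [Category.assoc, hW, ht₃, zero_comp]
      · apply Limits.prod.hom_ext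
        · simp only [Category.assoc, hX, reassoc_of% ht₁, zero_comp]
        · simp only [Category.assoc, hY, reassoc_of% ht₂, zero_comp]
    simpa using kernel.lift _ t ht ≫= h
  · rw [← cancel_mono (coprod.braiding W X).hom, Category.assoc, ← hX, kernel.condition_assoc,
      zero_comp, zero_comp]
  · rw [← cancel_mono (coprod.braiding W Y).hom, Category.assoc, ← hY, kernel.condition_assoc,
      zero_comp, zero_comp]
  · rw [← hW, kernel.condition_assoc, zero_comp]

/-- The kernel of `X + Y + W ⟶ (W + X) ×_W (W + Y)` is a split extension of `X ⋄ Y` by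
`X ⋄ Y ⋄ W`. -/
theorem commuteOver_iff_commutator_eq_bot {W X Y D : C} (x : X ⟶ D) (y : Y ⟶ D) (w : W ⟶ D)
    [Mono x] [Mono y] [Mono w] :
    CommuteOver x y w ↔ commutator₂ x y = ⊥ ∧ commutator₃ x y w = ⊥ := by
  rw [commuteOver_iff_kernel, commutator₂_eq_bot_iff, commutator₃_eq_bot_iff]
  let i : X ⨿ Y ⟶ X ⨿ (Y ⨿ W) := coprod.map (𝟙 X) coprod.inl
  have hi : i ≫ coprod.desc x (coprod.desc y w) = coprod.desc x y := by
    apply coprod.hom_ext <;> simp [i]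
  have hiX : i ≫ dropSnd X Y W = binaryComparison X Y ≫ prod.fst ≫ coprod.inr := by
    apply coprod.hom_ext <;> simp [i, dropSnd, binaryComparison]
  have hiY : i ≫ dropFst X Y W = binaryComparison X Y ≫ prod.snd ≫ coprod.inr := by
    apply coprod.hom_ext <;> simp [i, dropFst, binaryComparison]
  have hiW : i ≫ dropWeight X Y W = 𝟙 _ := by
    apply coprod.hom_ext <;> simp [i, dropWeight]
  constructor
  · intro h
    refine ⟨?_, fun Z t h₁ h₂ _ ↦ h t h₁ h₂⟩
    rw [← hi, ← Category.assoc]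
    apply h
    · simp [hiX]
    · simp [hiY]
  · rintro ⟨h₂, h₃⟩ Z t ht₁ ht₂
    -- Mapping to the product instead of the pullback leaves the kernel K unchanged.
    let c := prod.lift (dropSnd X Y W) (dropFst X Y W)
    have hX : kernel.ι c ≫ dropSnd X Y W = 0 := by
      simpa [c] using kernel.condition c =≫ prod.fst
    have hY : kernel.ι c ≫ dropFst X Y W = 0 := by
      simpa [c] using kernel.condition c =≫ prod.snd
    have hcomp : dropWeight X Y W ≫ binaryComparison X Y =
        c ≫ prod.map (coprod.desc 0 (𝟙 X)) (coprod.desc 0 (𝟙 Y)) := by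
      apply coprod.hom_ext
      · apply Limits.prod.hom_ext <;> simp [dropWeight, binaryComparison, c, dropSnd, dropFst]
      · apply coprod.hom_ext <;> apply Limits.prod.hom_ext <;>
          simp [dropWeight, binaryComparison, c, dropSnd, dropFst]
    let p : kernel c ⟶ kernel (binaryComparison X Y) :=
      kernel.map _ _ (dropWeight X Y W) _ hcomp.symm
    let s : kernel (binaryComparison X Y) ⟶ kernel c :=
      kernel.lift c (kernel.ι _ ≫ i) (by apply Limits.prod.hom_ext <;> simp [c, hiX, hiY])
    have hpι : p ≫ kernel.ι _ = kernel.ι _ ≫ dropWeight X Y W := kernel.lift_ι _ _ _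
    have hs : s ≫ p = 𝟙 _ := by
      rw [← cancel_mono (kernel.ι _)]
      simp [s, p, hiW]
    have key : kernel.ι c ≫ coprod.desc x (coprod.desc y w) = 0 := by
      refine hom_ext_of_section_of_kernel hs (by simp [s, hi, h₂]) ?_
      rw [comp_zero, ← Category.assoc]
      apply h₃
      · simp [hX]
      · simp [hY]
      · rw [Category.assoc, ← hpι, kernel.condition_assoc, zero_comp]
    have ht : t ≫ c = 0 := by apply Limits.prod.hom_ext <;> simp [c, ht₁, ht₂]
    simpa using kernel.lift c t ht ≫= key

end WeightedCommutator

theorem mainTheorem2 {C : Type u} [Category.{v} C] [HasZeroMorphisms C]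
    [WeightedCommutator.Homological C] [HasFiniteColimits C]
    {W X Y D : C} (x : X ⟶ D) (y : Y ⟶ D) (w : W ⟶ D) [NormalMono x] [NormalMono y] :
    WeightedCommutator.CommuteOver x y w ↔
      WeightedCommutator.commutator₂ x y = ⊥ ∧
        WeightedCommutator.commutator₃ x y (image.ι w) = ⊥ := by
  rw [← WeightedCommutator.commuteOver_iff_commutator_eq_bot,
    ← WeightedCommutator.commuteOver_strongEpi_comp_iff x y (factorThruImage w), image.fac]
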